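/- Let $\mathscr{C}$ be a skeletally small Krull–Schmidt additive category with an extriangulated structure $(\mathbb{E},\mathfrak{s})$ in the sense of Nakaoka and Palu. For a class $\mathcal{X}$ of objects of $\mathscr{C}$, closed under isomorphisms, an $\mathcal{X}$-filtration of length $n\ge 0$ of an object $M$ is a sequence $$0=M_0\xrightarrow{f_0}M_1\xrightarrow{f_1}\cdots\xrightarrow{f_{n-1}}M_n=M$$ of inflations with $\operatorname{cone}(f_i)\in\mathcal{X}$ for $0\le i\le n-1$; one writes $M\sim(\operatorname{cone}(f_0),\dots,\operatorname{cone}(f_{n-1}))_{\mathcal{X}}$. Let $\mathbf{Filt}_{\mathscr{C}}(\mathcal{X})$ be the full subcategory of all objects that have an $\mathcal{X}$-filtration, and for such an object $M$ let $l_{\mathcal{X}}(M)$ be the minimal length of its $\mathcal{X}$-filtrations. Let $\mathcal{X}$ be a semibrick in $\mathscr{C}$: a set of isomorphism classes of objects whose endomorphism rings are division rings, such that $\operatorname{Hom}_{\mathscr{C}}(X,Y)=0$ for any two non-isomorphic $X,Y\in\mathcal{X}$. Put $\mathcal{T}=\mathbf{Filt}_{\mathscr{C}}(\mathcal{X})$.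 Then $\mathcal{X}\subseteq\mathcal{T}$, the subcategory $\mathcal{T}$ is closed under extensions in $\mathscr{C}$, and with the structure inherited from $\mathscr{C}$ (restrict $\mathbb{E}$; the conflations in $\mathcal{T}$ are the conflations of $\mathscr{C}$ with all three terms in $\mathcal{T}$) $\mathcal{T}$ satisfies the weak Jordan–Hölder property with respect to $\mathcal{X}$, that is: 1. $\mathcal{T}=\mathbf{Filt}_{\mathcal{T}}(\mathcal{X})$; 2. for each $M\in\mathcal{T}$ with $l_{\mathcal{X}}(M)=n$ (computed in $\mathcal{T}$), if $M\sim(X_1,\dots,X_n)_{\mathcal{X}}$ and $M\sim(Y_1,\dots,Y_n)_{\mathcal{X}}$ in $\mathcal{T}$, then there is a permutation $\sigma$ of $\{1,\dots,n\}$ with $X_i\cong Y_{\sigma(i)}$ for all $i$. -/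

import Mathlib

open CategoryTheory CategoryTheory.Limits

universe w v u

attribute [local instance] hasBinaryBiproducts_of_finite_biproducts

namespace Extri

/-- The data underlying an extriangulated category: a bifunctor `𝔼 : Cᵒᵖ × C → Ab`
(in curried form) and a correspondence between elements of `𝔼(Z, A)` and sequences
`A ⟶ B ⟶ Z`. `Realizes δ x y` means that the sequence `(x, y)` belongs to the class `𝔰(δ)`.
The axioms are in `ExtData.IsExtriangulated`. -/
structure ExtData (C : Type u) [Category.{v} C] where
  /-- The bifunctor of extensions. -/
  E : Cᵒᵖ ⥤ C ⥤ AddCommGrpCat.{w}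
  /-- The sequence `A ⟶ B ⟶ Z` belongs to the class `𝔰(δ)`. -/
  Realizes : ∀ {A B Z : C}, ((E.obj (Opposite.op Z)).obj A) → (A ⟶ B) → (B ⟶ Z) → Prop

namespace ExtData

section Data

variable {C : Type u} [Category.{v} C] (D : ExtData.{w} C)

/-- The group `𝔼(Z, A)` of extensions. -/
abbrev Ext (Z A : C) : Type w := (D.E.obj (Opposite.op Z)).obj A

variable {D}

/-- `a_* δ = 𝔼(Z, a)(δ)`. -/
def push {Z A A' : C} (a : A ⟶ A') (δ : D.Ext Z A) : D.Ext Z A' :=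
  (D.E.obj (Opposite.op Z)).map a δ

/-- `c^* δ = 𝔼(c, A)(δ)`. -/
def pull {Z Z' A : C} (c : Z' ⟶ Z) (δ : D.Ext Z A) : D.Ext Z' A :=
  (D.E.map c.op).app A δ

variable (D)

/-- Conflations: the sequences `A ⟶ B ⟶ Z` which realize some extension. Then `x` is an
inflation, `y` is a deflation and `Z = cone x`. -/
def Conflation {A B Z : C} (x : A ⟶ B) (y : B ⟶ Z) : Prop :=
  ∃ δ : D.Ext Z A, D.Realizes δ x y

/-- The data inherited by a full subcategory `T`: the bifunctor is the restriction of `𝔼`, and a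
sequence in `T` realizes `δ` exactly if it does so in `C`. -/
def restrict (T : ObjectProperty C) : ExtData.{w} T.FullSubcategory where
  E := T.ι.op ⋙ D.E ⋙ (Functor.whiskeringLeft _ _ _).obj T.ι
  Realizes {A _ Z} δ x y :=
    D.Realizes (show D.Ext (T.ι.obj Z) (T.ι.obj A) from δ) (T.ι.map x) (T.ι.map y)

/-- `D.HasFiltration 𝒳 M [X₁, …, Xₙ]` says that there is an `𝒳`-filtration
`0 = M₀ ⟶ M₁ ⟶ ⋯ ⟶ Mₙ = M` by inflations, with `cone (M_{i-1} ⟶ M_i) = X_i` in `𝒳` for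
`i = 1, …, n`, i.e. that `M ∼ (X₁, …, Xₙ)_𝒳`. -/
inductive HasFiltration (𝒳 : ObjectProperty C) : C → List C → Prop
  | zero {M : C} (hM : IsZero M) : HasFiltration 𝒳 M []
  | step {M N X : C} {l : List C} (f : M ⟶ N) (g : N ⟶ X) (h : D.Conflation f g) (hX : 𝒳 X)
      (hM : HasFiltration 𝒳 M l) : HasFiltration 𝒳 N (l ++ [X])

/-- The filtration subcategory `Filt_C(𝒳)`. -/
def Filt (𝒳 : ObjectProperty C) : ObjectProperty C :=
  fun M => ∃ l : List C, D.HasFiltration 𝒳 M l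

/-- The `𝒳`-length of `M`: the minimal length of an `𝒳`-filtration of `M`
(used only for objects which have an `𝒳`-filtration). -/
noncomputable def length (𝒳 : ObjectProperty C) (M : C) : ℕ :=
  sInf {n : ℕ | ∃ l : List C, D.HasFiltration 𝒳 M l ∧ l.length = n}

/-- The subcategory `T` is closed under extensions. -/
def IsExtensionClosed (T : ObjectProperty C) : Prop :=
  ∀ ⦃A B Z : C⦄ (x : A ⟶ B) (y : B ⟶ Z), D.Conflation x y → T A → T Z → T B

end Data

/-- Two sequences of objects are isomorphic: they have the same length, and some permutation
matches their terms up to isomorphism. -/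
def SeqIso {C : Type u} [Category.{v} C] (l l' : List C) : Prop :=
  ∃ σ : Fin l.length ≃ Fin l'.length, ∀ i, Nonempty (l.get i ≅ l'.get (σ i))

/-- The weak Jordan–Hölder property of `C` with respect to the set `𝒳` of objects of `C`:
`C = Filt_C(𝒳)`, and all `𝒳`-filtrations of minimal length of an object have isomorphic sequences
of factors. -/
structure WeakJordanHolder {C : Type u} [Category.{v} C] (D : ExtData.{w} C)
    (𝒳 : ObjectProperty C) : Prop where
  filt : ∀ M : C, D.Filt 𝒳 M
  unique : ∀ (M : C) (l l' : List C), D.HasFiltration 𝒳 M l → D.HasFiltration 𝒳 M l' →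
    l.length = D.length 𝒳 M → l'.length = D.length 𝒳 M → SeqIso l l'

section Axioms

variable {C : Type u} [Category.{v} C] [Preadditive C] [HasFiniteBiproducts C]

/-- The extension `δ ⊕ δ'` in `𝔼(Z ⊕ Z', A ⊕ A')`, which corresponds to `(δ, 0, 0, δ')`. -/
noncomputable def sum {D : ExtData.{w} C} {Z Z' A A' : C} (δ : D.Ext Z A) (δ' : D.Ext Z' A') :
    D.Ext (Z ⊞ Z') (A ⊞ A') :=
  push (biprod.inl : A ⟶ A ⊞ A') (pull (biprod.fst : Z ⊞ Z' ⟶ Z) δ) +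
    push (biprod.inr : A' ⟶ A ⊞ A') (pull (biprod.snd : Z ⊞ Z' ⟶ Z') δ')

/-- The axioms of an extriangulated category, in the sense of Nakaoka and Palu. -/
structure IsExtriangulated (D : ExtData.{w} C) : Prop where
  /-- (ET1): `𝔼` is additive in each variable. -/
  additive_right : ∀ Z : Cᵒᵖ, (D.E.obj Z).Additive
  additive_left : ∀ A : C, (D.E.flip.obj A).Additive
  /-- (ET2), first part: `𝔰(δ)` is an equivalence class of sequences, where `A ⟶ B ⟶ Z` and
  `A ⟶ B' ⟶ Z` are equivalent if there is a compatible isomorphism `B ≅ B'`. -/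
  exists_realizes : ∀ {A Z : C} (δ : D.Ext Z A),
    ∃ (B : C) (x : A ⟶ B) (y : B ⟶ Z), D.Realizes δ x y
  realizes_of_iso : ∀ {A B B' Z : C} (δ : D.Ext Z A) (x : A ⟶ B) (y : B ⟶ Z) (b : B ≅ B'),
    D.Realizes δ x y → D.Realizes δ (x ≫ b.hom) (b.inv ≫ y)
  iso_of_realizes : ∀ {A B B' Z : C} (δ : D.Ext Z A) (x : A ⟶ B) (y : B ⟶ Z) (x' : A ⟶ B')
    (y' : B' ⟶ Z), D.Realizes δ x y → D.Realizes δ x' y' →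
    ∃ b : B ≅ B', x ≫ b.hom = x' ∧ b.hom ≫ y' = y
  /-- (ET2), second part: morphisms of extensions are realized. -/
  realizes_hom : ∀ {A B Z A' B' Z' : C} (δ : D.Ext Z A) (δ' : D.Ext Z' A') (x : A ⟶ B)
    (y : B ⟶ Z) (x' : A' ⟶ B') (y' : B' ⟶ Z') (a : A ⟶ A') (c : Z ⟶ Z'),
    D.Realizes δ x y → D.Realizes δ' x' y' → push a δ = pull c δ' →
    ∃ b : B ⟶ B', x ≫ b = a ≫ x' ∧ b ≫ y' = y ≫ c
  /-- (ET2), third part: `𝔰` is additive. -/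
  realizes_zero : ∀ A Z : C,
    D.Realizes (0 : D.Ext Z A) (biprod.inl : A ⟶ A ⊞ Z) (biprod.snd : A ⊞ Z ⟶ Z)
  realizes_sum : ∀ {A B Z A' B' Z' : C} (δ : D.Ext Z A) (δ' : D.Ext Z' A') (x : A ⟶ B)
    (y : B ⟶ Z) (x' : A' ⟶ B') (y' : B' ⟶ Z'), D.Realizes δ x y → D.Realizes δ' x' y' →
    D.Realizes (sum δ δ') (biprod.map x x') (biprod.map y y')
  /-- (ET3) -/
  et3 : ∀ {A B Z A' B' Z' : C} (δ : D.Ext Z A) (δ' : D.Ext Z' A') (x : A ⟶ B) (y : B ⟶ Z)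
    (x' : A' ⟶ B') (y' : B' ⟶ Z') (a : A ⟶ A') (b : B ⟶ B'),
    D.Realizes δ x y → D.Realizes δ' x' y' → x ≫ b = a ≫ x' →
    ∃ c : Z ⟶ Z', b ≫ y' = y ≫ c ∧ push a δ = pull c δ'
  /-- (ET3)ᵒᵖ -/
  et3_op : ∀ {A B Z A' B' Z' : C} (δ : D.Ext Z A) (δ' : D.Ext Z' A') (x : A ⟶ B) (y : B ⟶ Z)
    (x' : A' ⟶ B') (y' : B' ⟶ Z') (b : B ⟶ B') (c : Z ⟶ Z'),
    D.Realizes δ x y → D.Realizes δ' x' y' → b ≫ y' = y ≫ c →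
    ∃ a : A ⟶ A', x ≫ b = a ≫ x' ∧ push a δ = pull c δ'
  /-- (ET4) for `A ⟶ B ⟶ K` and `B ⟶ M ⟶ F`. -/
  et4 : ∀ {A B K M F : C} (δ : D.Ext K A) (δ' : D.Ext F B) (f : A ⟶ B) (f' : B ⟶ K)
    (g : B ⟶ M) (g' : M ⟶ F), D.Realizes δ f f' → D.Realizes δ' g g' →
    ∃ (N : C) (h' : M ⟶ N) (d : K ⟶ N) (e : N ⟶ F) (δ'' : D.Ext N A),
      D.Realizes δ'' (f ≫ g) h' ∧ f' ≫ d = g ≫ h' ∧ h' ≫ e = g' ∧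
      D.Realizes (push f' δ') d e ∧ pull d δ'' = δ ∧ push f δ'' = pull e δ'
  /-- (ET4)ᵒᵖ for `K ⟶ A ⟶ B` and `F ⟶ B ⟶ M`. -/
  et4_op : ∀ {A B K M F : C} (δ : D.Ext B K) (δ' : D.Ext M F) (f' : K ⟶ A) (f : A ⟶ B)
    (g' : F ⟶ B) (g : B ⟶ M), D.Realizes δ f' f → D.Realizes δ' g' g →
    ∃ (N : C) (h' : N ⟶ A) (d : K ⟶ N) (e : N ⟶ F) (δ'' : D.Ext M N),
      D.Realizes δ'' h' (f ≫ g) ∧ d ≫ h' = f' ∧ h' ≫ f = e ≫ g' ∧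
      D.Realizes (pull g' δ) d e ∧ push e δ'' = δ' ∧ push d δ = pull g δ''

end Axioms

end ExtData

/-- An additive category is Krull–Schmidt if every object is a finite direct sum of objects with
local endomorphism rings. -/
def IsKrullSchmidt (C : Type u) [Category.{v} C] [Preadditive C] [HasFiniteBiproducts C] : Prop :=
  ∀ M : C, ∃ (n : ℕ) (X : Fin n → C),
    (∀ i, IsLocalRing (End (X i))) ∧ Nonempty (M ≅ ⨁ X)

/-- A brick: an object whose endomorphism ring is a division ring. -/
def IsBrick {C : Type u} [Category.{v} C] [Preadditive C] (X : C) : Prop :=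
  Nontrivial (End X) ∧ ∀ f : End X, f ≠ 0 → IsUnit f

/-- A semibrick. A set of isomorphism classes of objects is the same as a property of objects
which is closed under isomorphisms. -/
structure IsSemibrick {C : Type u} [Category.{v} C] [Preadditive C] (𝒳 : ObjectProperty C) :
    Prop where
  closedUnderIso : 𝒳.IsClosedUnderIsomorphisms
  brick : ∀ X, 𝒳 X → IsBrick X
  hom_eq_zero : ∀ X Y, 𝒳 X → 𝒳 Y → ¬ Nonempty (X ≅ Y) → ∀ f : X ⟶ Y, f = 0

end Extri

/-! ### Functoriality of extensions. -/

namespace Extri.ExtData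

variable {C : Type u} [Category.{v} C] {D : ExtData.{w} C}

/-! Schur's lemma for a semibrick extends to filtered objects: a nonzero `f : M ⟶ S` is, up to an
isomorphism of `S`, a deflation whose fibre is filtered by the factors of `M` with one copy of `S`
removed (`exists_fibre_of_ne_zero`). Now compare two minimal filtrations of `M`, the second ending
with the deflation `y : M ⟶ S`. Unlike in an exact category, `y` may vanish; but then `M` has a
filtration no longer than that of the fibre (`exists_hasFiltration_of_deflation_zero`), against
minimality. So `y ≠ 0`, and a copy of `S` can be removed from the first filtration as well. Fibres
are unique up to isomorphism, so induction applies to the fibre. -/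

theorem pull_zero {Z Z' A : C} (c : Z' ⟶ Z) : pull c (0 : D.Ext Z A) = 0 :=
  map_zero ((D.E.map c.op).app A).hom

theorem pull_id {Z A : C} (δ : D.Ext Z A) : pull (𝟙 Z) δ = δ := by
  simp [pull]

theorem push_id {Z A : C} (δ : D.Ext Z A) : push (𝟙 A) δ = δ := by
  simp [push]

theorem push_comp {Z A A' A'' : C} (a : A ⟶ A') (b : A' ⟶ A'') (δ : D.Ext Z A) :
    push (a ≫ b) δ = push b (push a δ) := by
  simp [push]

theorem pull_comp {Z Z' Z'' A : C} (c : Z' ⟶ Z) (d : Z'' ⟶ Z') (δ : D.Ext Z A) :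
    pull (d ≫ c) δ = pull d (pull c δ) := by
  simp [pull]

theorem push_pull {Z Z' A A' : C} (a : A ⟶ A') (c : Z' ⟶ Z) (δ : D.Ext Z A) :
    push a (pull c δ) = pull c (push a δ) :=
  (ConcreteCategory.congr_hom ((D.E.map c.op).naturality a) δ).symm

/-! ### Factorization, fibres and deflations in an extriangulated category. -/

namespace IsExtriangulated

variable [Preadditive C] [HasFiniteBiproducts C]

theorem push_sub_hom (hD : D.IsExtriangulated) {Z A A' : C} (a b : A ⟶ A') (δ : D.Ext Z A) :
    push (a - b) δ = push a δ - push b δ := by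
  have := hD.additive_right (Opposite.op Z)
  simp [push, Functor.map_sub]

theorem eq_zero_of_isZero (hD : D.IsExtriangulated) {Z A : C} (hZ : IsZero Z)
    (δ : D.Ext Z A) : δ = 0 := by
  have := hD.additive_left A
  rw [← pull_id δ, hZ.eq_of_src (𝟙 Z) 0]
  have h : (D.E.flip.obj A).map (0 : Z ⟶ Z).op = 0 := by
    rw [op_zero, Functor.map_zero]
  exact congrArg (fun φ => φ δ) h


/-- A morphism which vanishes on an inflation factors through its cone. -/
theorem exists_desc (hD : D.IsExtriangulated) {A B Z W : C} {x : A ⟶ B} {y : B ⟶ Z}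
    (h : D.Conflation x y) (f : B ⟶ W) (hf : x ≫ f = 0) : ∃ c : Z ⟶ W, y ≫ c = f := by
  obtain ⟨δ, h⟩ := h
  -- Compare with the split conflation `A ⟶ A ⊞ W ⟶ W`.
  obtain ⟨c, hc, -⟩ := hD.et3 _ _ _ _ _ _ 0 (f ≫ biprod.inr) h
    (hD.realizes_zero A W) (by rw [← Category.assoc, hf, zero_comp, zero_comp])
  exact ⟨c, by simpa using hc.symm⟩

/-- A morphism which is annihilated by a deflation factors through its fibre. -/
theorem exists_lift (hD : D.IsExtriangulated) {A B Z W : C} {x : A ⟶ B} {y : B ⟶ Z}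
    (h : D.Conflation x y) (f : W ⟶ B) (hf : f ≫ y = 0) : ∃ a : W ⟶ A, a ≫ x = f := by
  obtain ⟨δ, h⟩ := h
  obtain ⟨a, ha, -⟩ := hD.et3_op _ _ _ _ _ _ (biprod.fst ≫ f) 0
    (hD.realizes_zero W Z) h (by rw [Category.assoc, hf, comp_zero, comp_zero])
  exact ⟨a, by simpa using ha.symm⟩

theorem push_comp_inflation (hD : D.IsExtriangulated) {A B Z W : C} {x : A ⟶ B} {y : B ⟶ Z}
    {δ : D.Ext Z A} (h : D.Realizes δ x y) (f : B ⟶ W) : push (x ≫ f) δ = 0 := by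
  obtain ⟨c, -, hc⟩ := hD.et3 _ _ _ _ _ _ (x ≫ f) (f ≫ biprod.inl) h
    (hD.realizes_zero W Z) (by simp)
  rw [hc, pull_zero]

/-- A morphism which annihilates an extension extends along the inflation. -/
theorem exists_extend (hD : D.IsExtriangulated) {A B Z W : C} {x : A ⟶ B} {y : B ⟶ Z}
    {δ : D.Ext Z A} (h : D.Realizes δ x y) (f : A ⟶ W) (hf : push f δ = 0) :
    ∃ t : B ⟶ W, x ≫ t = f := by
  obtain ⟨b, hb, -⟩ := hD.realizes_hom _ _ _ _ _ _ f (𝟙 Z) h (hD.realizes_zero W Z)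
    (by rw [hf, pull_zero])
  exact ⟨b ≫ biprod.fst, by rw [← Category.assoc, hb]; simp⟩

/-- Since `a - 𝟙 A` kills `δ`, it factors through `x`; since it also equalizes to zero with `x`, its
square is zero. Hence `a` is unipotent, with inverse `2 - a`. -/
theorem isIso_of_realizes (hD : D.IsExtriangulated) {A B Z : C} {x : A ⟶ B} {y : B ⟶ Z}
    {δ : D.Ext Z A} (h : D.Realizes δ x y) (a : A ⟶ A) (ha : push a δ = δ) (hx : a ≫ x = x) :
    IsIso a := by
  obtain ⟨t, ht⟩ := hD.exists_extend h (a - 𝟙 A)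
    (by rw [hD.push_sub_hom, ha, push_id, sub_self])
  have h0 : (a - 𝟙 A) ≫ (a - 𝟙 A) = 0 := by
    nth_rw 2 [← ht]
    rw [← Category.assoc, Preadditive.sub_comp, hx, Category.id_comp, sub_self, zero_comp]
  have h1 : a ≫ a = a + a - 𝟙 A := by
    simp only [Preadditive.sub_comp, Preadditive.comp_sub, Category.id_comp,
      Category.comp_id] at h0
    rw [← sub_eq_zero, ← h0]
    abel
  exact ⟨𝟙 A + 𝟙 A - a, by
    simp only [Preadditive.comp_sub, Preadditive.comp_add, Category.comp_id, h1]; abel, by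
    simp only [Preadditive.sub_comp, Preadditive.add_comp, Category.id_comp, h1]; abel⟩

/-- The fibre of a deflation is unique up to isomorphism. -/
theorem nonempty_fibre_iso (hD : D.IsExtriangulated) {A A' B Z Z' : C} {x : A ⟶ B} {y : B ⟶ Z}
    {x' : A' ⟶ B} {y' : B ⟶ Z'} (h : D.Conflation x y) (h' : D.Conflation x' y') (e : Z ≅ Z')
    (he : y ≫ e.hom = y') : Nonempty (A ≅ A') := by
  obtain ⟨δ, h⟩ := h
  obtain ⟨δ', h'⟩ := h'
  obtain ⟨a, ha, hδ⟩ := hD.et3_op _ _ _ _ _ _ (𝟙 B) e.hom h h' (by simp [he])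
  obtain ⟨b, hb, hδ'⟩ := hD.et3_op _ _ _ _ _ _ (𝟙 B) e.inv h' h (by simp [← he])
  rw [Category.comp_id] at ha hb
  have h1 : IsIso (a ≫ b) := hD.isIso_of_realizes h _
    (by rw [push_comp, hδ, push_pull, hδ', ← pull_comp, e.hom_inv_id, pull_id])
    (by rw [Category.assoc, ← hb, ← ha])
  have h2 : IsIso (b ≫ a) := hD.isIso_of_realizes h' _
    (by rw [push_comp, hδ', push_pull, hδ, ← pull_comp, e.inv_hom_id, pull_id])
    (by rw [Category.assoc, ← ha, ← hb])
  have : IsSplitMono a := ⟨⟨⟨b ≫ inv (a ≫ b), by simp [← Category.assoc]⟩⟩⟩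
  have : Epi a := by
    have : Epi (b ≫ a) := inferInstance
    exact epi_of_epi b a
  have : IsIso a := isIso_of_epi_of_isSplitMono a
  exact ⟨asIso a⟩

/-- An extension by a zero object is an isomorphism. -/
theorem nonempty_iso_of_isZero (hD : D.IsExtriangulated) {A B Z : C} {x : A ⟶ B} {y : B ⟶ Z}
    (h : D.Conflation x y) (hZ : IsZero Z) : Nonempty (A ≅ B) := by
  obtain ⟨δ, h⟩ := h
  rw [hD.eq_zero_of_isZero hZ δ] at h
  obtain ⟨b, -, -⟩ := hD.iso_of_realizes _ _ _ _ _ (hD.realizes_zero A Z) h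
  refine ⟨⟨biprod.inl, biprod.fst, by simp, ?_⟩ ≪≫ b⟩
  apply biprod.hom_ext
  · simp
  · exact hZ.eq_of_tgt _ _

/-- If `A ⟶ M ⟶ Z` is a conflation and the restriction of `f : M ⟶ S` to `A` is a deflation
with fibre `A'`, then `f` is a deflation, whose fibre is an extension of `Z` by `A'`. -/
theorem deflation_of_restrict (hD : D.IsExtriangulated) {A A' M S Z : C} {i : A' ⟶ A} {h : A ⟶ S}
    {x : A ⟶ M} {y : M ⟶ Z} (hA : D.Conflation i h) (hM : D.Conflation x y) (f : M ⟶ S)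
    (hf : x ≫ f = h) :
    ∃ (Y : C) (k : Y ⟶ M) (d : A' ⟶ Y),
      D.Conflation k f ∧ D.Conflation d (k ≫ y) := by
  obtain ⟨δ, hδ⟩ := hA
  obtain ⟨δ', hδ'⟩ := hM
  obtain ⟨N, p, d, e, δ'', hp, hd, he, hde, -, -⟩ := hD.et4 _ _ _ _ _ _ hδ hδ'
  -- Because `h` extends to `f` along `x`, the conflation `S ⟶ N ⟶ Z` splits.
  rw [← hf, hD.push_comp_inflation hδ' f] at hde
  obtain ⟨b, hb1, hb2⟩ := hD.iso_of_realizes _ _ _ _ _ (hD.realizes_zero S Z) hde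
  -- On `A`, `f` agrees with the projection of `M` to the summand `S` of `N`; `c` measures the
  -- difference.
  obtain ⟨c, hc⟩ := hD.exists_desc ⟨δ', hδ'⟩ (f - p ≫ b.inv ≫ biprod.fst) (by
    rw [Preadditive.comp_sub, ← Category.assoc x p, ← hd, Category.assoc h, ← hb1]
    simp [hf])
  -- This shear turns the projection to `S` into `(𝟙, c) : S ⊞ Z ⟶ S`, whose composite with `p` is
  -- `f`. Thus `f` is a composite of two deflations.
  let φ : Z ⊞ S ≅ S ⊞ Z :=
    { hom := biprod.lift (biprod.snd - biprod.fst ≫ c) biprod.fst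
      inv := biprod.lift biprod.snd (biprod.desc (𝟙 S) c)
      hom_inv_id := by
        apply biprod.hom_ext <;> simp [biprod.lift_desc]
      inv_hom_id := by
        apply biprod.hom_ext <;> simp [biprod.desc_eq] }
  have hr := hD.realizes_of_iso _ _ _ (φ ≪≫ b) (hD.realizes_zero Z S)
  obtain ⟨Y, k, d', e', ε, hk, -, hke, hY, -, -⟩ := hD.et4_op _ _ _ _ _ _ hp hr
  have hpf : p ≫ (φ ≪≫ b).inv ≫ biprod.snd = f := by
    have : p ≫ b.inv ≫ biprod.snd ≫ c = y ≫ c := by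
      rw [← he, ← reassoc_of% hb2]; simp
    simp only [φ, Iso.trans_inv, Category.assoc, biprod.lift_snd, biprod.desc_eq,
      Preadditive.comp_add, Category.comp_id]
    rw [this, hc]
    abel
  rw [hpf] at hk
  refine ⟨Y, k, d', ⟨_, hk⟩, ?_⟩
  have : k ≫ y = e' := by
    rw [← he, ← Category.assoc, hke]
    simp [φ, hb2]
  rw [this]
  exact ⟨_, hY⟩

end IsExtriangulated
end Extri.ExtData

/-! ### Isomorphism classes and Schur's lemma. -/

namespace Extri

variable {C : Type u} [Category.{v} C]

/-- The isomorphism class of an object. -/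
def isoClass (X : C) : Quotient (isIsomorphicSetoid C) :=
  Quotient.mk _ X

theorem isoClass_eq {X Y : C} (e : X ≅ Y) : isoClass X = isoClass Y :=
  Quotient.sound ⟨e⟩

open Classical in
theorem seqIso_of_perm {l l' : List C} (h : (l.map isoClass).Perm (l'.map isoClass)) :
    ExtData.SeqIso l l' := by
  refine ⟨(finCongr (by simp)).trans (({
    toFun := h.idxBij
    invFun := h.symm.idxBij
    left_inv := h.idxBij_rightInverse_idxBij_symm
    right_inv := h.idxBij_leftInverse_idxBij_symm } : Fin _ ≃ Fin _).trans
      (finCongr (by simp))), fun i => ?_⟩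
  have := h.getElem_idxBij_eq_getElem (Fin.cast (by simp) i)
  rw [List.getElem_map, List.getElem_map] at this
  exact (Quotient.exact this.symm)

namespace IsSemibrick

variable [Preadditive C] {𝒳 : ObjectProperty C}

theorem isIso_of_ne_zero (h𝒳 : IsSemibrick 𝒳) {X Y : C} (hX : 𝒳 X) (hY : 𝒳 Y) {f : X ⟶ Y}
    (hf : f ≠ 0) : IsIso f := by
  by_cases h : Nonempty (X ≅ Y)
  · obtain ⟨e⟩ := h
    have h1 : IsUnit (show End X from f ≫ e.inv) := (h𝒳.brick X hX).2 _ fun h0 => hf (by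
      have : (f ≫ e.inv) ≫ e.hom = 0 ≫ e.hom := congrArg (· ≫ e.hom) h0
      simpa using this)
    have : IsIso (f ≫ e.inv) := (isUnit_iff_isIso _).1 h1
    exact IsIso.of_isIso_comp_right f e.inv
  · exact absurd (h𝒳.hom_eq_zero X Y hX hY h f) hf

end IsSemibrick

namespace ExtData

variable {D : ExtData.{w} C} {𝒳 : ObjectProperty C}

theorem HasFiltration.isZero_of_nil {M : C} (h : D.HasFiltration 𝒳 M []) : IsZero M := by
  generalize hl : ([] : List C) = l at h
  cases h with
  | zero hM => exact hM
  | step => simp at hl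

/-! ### Filtrations by a semibrick. -/

namespace IsExtriangulated

variable [Preadditive C] [HasFiniteBiproducts C]

theorem hasFiltration_of_iso (hD : D.IsExtriangulated) {M N : C} {l : List C} (e : M ≅ N)
    (h : D.HasFiltration 𝒳 M l) : D.HasFiltration 𝒳 N l := by
  cases h with
  | zero hM => exact .zero (hM.of_iso e.symm)
  | step f g h hX hM =>
    obtain ⟨δ, hδ⟩ := h
    exact .step _ _ ⟨δ, hD.realizes_of_iso _ _ _ e hδ⟩ hX hM

theorem hasFiltration_singleton (hD : D.IsExtriangulated) {X : C} (hX : 𝒳 X) :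
    D.HasFiltration 𝒳 X [X] := by
  have hO : IsZero (⨁ (fun i : Fin 0 => nomatch i) : C) := by
    rw [IsZero.iff_id_eq_zero]
    exact biproduct.hom_ext _ _ fun i => i.elim0
  let e : (⨁ (fun i : Fin 0 => nomatch i) : C) ⊞ X ≅ X :=
    { hom := biprod.snd
      inv := biprod.inr
      hom_inv_id := by
        apply biprod.hom_ext
        · exact hO.eq_of_tgt _ _
        · simp
      inv_hom_id := by simp }
  exact .step (l := []) _ _ ⟨_, hD.realizes_of_iso _ _ _ e (hD.realizes_zero _ X)⟩ hX (.zero hO)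

/-- Filtrations of the outer terms of a conflation give a filtration of the middle term. -/
theorem hasFiltration_of_conflation (hD : D.IsExtriangulated) {A B Z : C} {x : A ⟶ B}
    {y : B ⟶ Z} {l l' : List C} (h : D.Conflation x y) (hA : D.HasFiltration 𝒳 A l)
    (hZ : D.HasFiltration 𝒳 Z l') : D.HasFiltration 𝒳 B (l ++ l') := by
  induction hZ generalizing B with
  | zero hZ =>
    obtain ⟨e⟩ := hD.nonempty_iso_of_isZero h hZ
    simpa using hD.hasFiltration_of_iso e hA
  | step f g hfg hX _ ih =>
    obtain ⟨δ, h⟩ := h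
    obtain ⟨δ', hfg⟩ := hfg
    obtain ⟨N, k, d, e, δ'', hk, -, -, hd, -, -⟩ := hD.et4_op _ _ _ _ _ _ h hfg
    rw [← List.append_assoc]
    exact .step _ _ ⟨_, hk⟩ hX (ih ⟨_, hd⟩)

/-- A nonzero morphism from a filtered object to an element of a semibrick is a deflation, and its
fibre has a filtration in which one factor is left out. -/
theorem exists_fibre_of_ne_zero (hD : D.IsExtriangulated) (h𝒳 : IsSemibrick 𝒳) {M S : C}
    {l : List C} (hM : D.HasFiltration 𝒳 M l) (hS : 𝒳 S) (f : M ⟶ S) (hf : f ≠ 0) :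
    ∃ (Y S' : C) (k : Y ⟶ M) (e : S ≅ S') (l' : List C), D.Conflation k (f ≫ e.hom) ∧
      D.HasFiltration 𝒳 Y l' ∧ (l.map isoClass).Perm ((S :: l').map isoClass) := by
  induction hM with
  | zero hM => exact absurd (hM.eq_of_src _ _) hf
  | @step A M Z l x y h hZ hA ih =>
    by_cases hxf : x ≫ f = 0
    · obtain ⟨c, hc⟩ := hD.exists_desc h f hxf
      have : IsIso c := h𝒳.isIso_of_ne_zero hZ hS fun h0 => hf (by rw [← hc, h0, comp_zero])
      -- The conflation ends in `Z`, not in `S`: (ET2) only replaces the middle term, hence the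
      -- isomorphism in the statement.
      refine ⟨A, Z, x, (asIso c).symm, l, ?_, hA, ?_⟩
      · simpa [← hc] using h
      · simp [isoClass_eq (asIso c).symm]
    · obtain ⟨Y, S', k, e, l', hk, hY, hl⟩ := ih (x ≫ f) hxf
      obtain ⟨Y', k', d, hk', hd⟩ := hD.deflation_of_restrict hk h (f ≫ e.hom) (by simp)
      refine ⟨Y', S', k', e, l' ++ [Z], hk', .step _ _ hd hZ hY, ?_⟩
      simpa using hl.append_right [isoClass Z]

/-- Maps from `M` lift down any filtration, so `𝟙 M` lifts to the zero object at its bottom. -/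
theorem isZero_of_hom_eq_zero (hD : D.IsExtriangulated) {M : C} (hM : D.Filt 𝒳 M)
    (h : ∀ S, 𝒳 S → ∀ f : M ⟶ S, f = 0) : IsZero M := by
  obtain ⟨l, hl⟩ := hM
  have key : ∀ (N : C) (l : List C), D.HasFiltration 𝒳 N l → ∀ f : M ⟶ N, f = 0 := by
    intro N l hN
    induction hN with
    | zero hN => exact fun f => hN.eq_of_tgt _ _
    | step x y hxy hX _ ih =>
      intro f
      obtain ⟨a, ha⟩ := hD.exists_lift hxy f (h _ hX _)
      rw [← ha, ih a, zero_comp]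
  exact (IsZero.iff_id_eq_zero M).2 (key M l hl _)

/-- If the deflation of the conflation `N ⟶ M ⟶ S` is zero, then `M` has a filtration which is not
longer than a given filtration of `N`. -/
theorem exists_hasFiltration_of_deflation_zero (hD : D.IsExtriangulated) (h𝒳 : IsSemibrick 𝒳)
    {N M S : C} {x : N ⟶ M} {y : M ⟶ S} {l : List C} (hN : D.HasFiltration 𝒳 N l) (hS : 𝒳 S)
    (h : D.Conflation x y) (hy : y = 0) :
    ∃ l', D.HasFiltration 𝒳 M l' ∧ l'.length ≤ l.length := by
  generalize hn : l.length = n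
  induction n generalizing N M l with
  | zero =>
    obtain ⟨s, hs⟩ := hD.exists_lift h (𝟙 M) (by simp [hy])
    rw [List.eq_nil_of_length_eq_zero hn] at hN
    refine ⟨[], .zero ?_, le_rfl⟩
    rw [IsZero.iff_id_eq_zero, ← hs, hN.isZero_of_nil.eq_of_src x 0, comp_zero]
  | succ n ih =>
    by_cases hM : ∀ S, 𝒳 S → ∀ f : M ⟶ S, f = 0
    · exact ⟨[], .zero (hD.isZero_of_hom_eq_zero ⟨_, .step x y h hS hN⟩ hM), Nat.zero_le _⟩
    · push Not at hM
      obtain ⟨S', hS', f, hf⟩ := hM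
      -- `M` is a retract of `N`, so `f` stays nonzero on `N`.
      obtain ⟨s, hs⟩ := hD.exists_lift h (𝟙 M) (by simp [hy])
      have hxf : x ≫ f ≠ 0 := fun h0 => hf (by
        rw [← Category.id_comp f, ← hs, Category.assoc, h0, comp_zero])
      obtain ⟨Y, T, k, e, l', hk, hY, hl⟩ := hD.exists_fibre_of_ne_zero h𝒳 hN hS' _ hxf
      obtain ⟨Y', k', d, hk', hd⟩ := hD.deflation_of_restrict hk h (f ≫ e.hom) (by simp)
      have hlen : l'.length = n := by simpa [hn, eq_comm] using hl.length_eq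
      -- The deflation `Y' ⟶ S` is again zero, and `Y` has one factor fewer than `N`.
      obtain ⟨l₂, hY', hl₂⟩ := ih hY hd (by simp [hy]) hlen
      have := h𝒳.closedUnderIso
      exact ⟨l₂ ++ [T], .step _ _ hk' (𝒳.prop_of_iso e hS') hY', by simpa using hl₂⟩

/-- The factors of two filtrations of minimal length agree up to order and isomorphism. -/
theorem perm_of_minimal (hD : D.IsExtriangulated) (h𝒳 : IsSemibrick 𝒳) {M : C} {l l' : List C}
    (hl : D.HasFiltration 𝒳 M l) (hl' : D.HasFiltration 𝒳 M l') (hlen : l'.length = l.length)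
    (hmin : ∀ l'', D.HasFiltration 𝒳 M l'' → l.length ≤ l''.length) :
    (l.map isoClass).Perm (l'.map isoClass) := by
  induction hl' generalizing l with
  | zero => rw [List.eq_nil_of_length_eq_zero hlen.symm]
  | @step N M S l₀ x y hxy hS hN ih =>
    by_cases hy : y = 0
    · obtain ⟨l'', h, hle⟩ := hD.exists_hasFiltration_of_deflation_zero h𝒳 hN hS hxy hy
      have := hmin _ h
      simp at hlen
      lia
    · obtain ⟨Y, T, k, e, l₁, hk, hY, hp⟩ := hD.exists_fibre_of_ne_zero h𝒳 hl hS y hy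
      obtain ⟨i⟩ := hD.nonempty_fibre_iso hxy hk e rfl
      have hlen₁ : l.length = l₁.length + 1 := by simpa using hp.length_eq
      have := ih (hD.hasFiltration_of_iso i.symm hY) (by simp at hlen; lia) fun l'' h'' => by
        -- Minimality passes to `N`: a shorter filtration of `N`, followed by `S`, would shorten
        -- that of `M`.
        have := hmin _ (.step x y hxy hS h'')
        simp at this
        lia
      rw [List.map_append]
      exact hp.trans ((this.cons _).trans (List.perm_append_singleton _ _).symm)

end IsExtriangulated

/-! ### Passage between `C` and the filtration subcategory. -/

theorem HasFiltration.of_restrict [Preadditive C] {T : ObjectProperty C} {M : T.FullSubcategory}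
    {l : List T.FullSubcategory}
    (h : (D.restrict T).HasFiltration (𝒳.inverseImage T.ι) M l) :
    D.HasFiltration 𝒳 M.obj (l.map (·.obj)) := by
  induction h with
  | zero hM =>
    exact .zero ((IsZero.iff_id_eq_zero _).2 (congrArg (·.hom) (hM.eq_of_src (𝟙 _) 0)))
  | step f g h hX _ ih =>
    rw [List.map_append]
    exact .step _ _ h hX ih

/-- Every intermediate term of a filtration is itself filtered, hence lies in `T`. -/
theorem HasFiltration.restrict {T : ObjectProperty C} (hT : 𝒳 ≤ T) (hF : D.Filt 𝒳 ≤ T) {M : C}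
    {l : List C} (h : D.HasFiltration 𝒳 M l) (hM : T M) :
    ∃ l' : List T.FullSubcategory,
      (D.restrict T).HasFiltration (𝒳.inverseImage T.ι) ⟨M, hM⟩ l' ∧ l'.map (·.obj) = l := by
  induction h with
  | zero h =>
    exact ⟨[], .zero (IsZero.of_full_of_faithful_of_isZero T.ι _ h), rfl⟩
  | @step M N X l f g h hX hl ih =>
    obtain ⟨l', hl', rfl⟩ := ih (hF _ ⟨_, hl⟩)
    exact ⟨l' ++ [⟨X, hT _ hX⟩], .step (X := ⟨X, hT _ hX⟩) (ObjectProperty.homMk f)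
      (ObjectProperty.homMk g) h hX hl', by simp⟩

theorem length_le {M : C} {l : List C} (h : D.HasFiltration 𝒳 M l) :
    D.length 𝒳 M ≤ l.length :=
  Nat.sInf_le ⟨l, h, rfl⟩

end ExtData

theorem ExtData.SeqIso.of_map_obj {T : ObjectProperty C} {l l' : List T.FullSubcategory}
    (h : ExtData.SeqIso (l.map (·.obj)) (l'.map (·.obj))) :
    ExtData.SeqIso l l' := by
  obtain ⟨σ, hσ⟩ := h
  refine ⟨(finCongr (by simp)).trans (σ.trans (finCongr (by simp))), fun i => ?_⟩
  obtain ⟨e⟩ := hσ (Fin.cast (by simp) i)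
  simp only [List.get_eq_getElem, List.getElem_map] at e
  exact ⟨T.isoMk e⟩

end Extri

theorem theorem3p4 {C : Type u} [Category.{v} C] [Preadditive C] [HasFiniteBiproducts C]
    [EssentiallySmall.{v} C] (hKS : Extri.IsKrullSchmidt C)
    (D : Extri.ExtData.{w} C) (hD : D.IsExtriangulated)
    (𝒳 : ObjectProperty C) (h𝒳 : Extri.IsSemibrick 𝒳) :
    𝒳 ≤ D.Filt 𝒳 ∧ D.IsExtensionClosed (D.Filt 𝒳) ∧
      (D.restrict (D.Filt 𝒳)).WeakJordanHolder (𝒳.inverseImage (D.Filt 𝒳).ι) := by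
  have hle : 𝒳 ≤ D.Filt 𝒳 := fun X hX => ⟨_, hD.hasFiltration_singleton hX⟩
  refine ⟨hle, ?_, ?_, ?_⟩
  · rintro A B Z x y h ⟨l, hA⟩ ⟨l', hZ⟩
    exact ⟨_, hD.hasFiltration_of_conflation h hA hZ⟩
  · rintro ⟨M, hM⟩
    obtain ⟨l, hl⟩ := hM
    obtain ⟨l', hl', -⟩ := hl.restrict hle le_rfl ⟨l, hl⟩
    exact ⟨l', hl'⟩
  · intro M l l' hl hl' hlen hlen'
    refine .of_map_obj (Extri.seqIso_of_perm (hD.perm_of_minimal h𝒳 hl.of_restrict hl'.of_restrict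
      (by simp [hlen, hlen']) fun l'' h'' => ?_))
    obtain ⟨l₀, hl₀, rfl⟩ := h''.restrict hle le_rfl M.property
    simpa [hlen] using Extri.ExtData.length_le hl₀
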